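/- Let $\{\phi_i\}_{i\in\mathbb Z}$ be neutral fermions, $\phi_i\phi_j+\phi_j\phi_i=(-1)^i\delta_{i+j,0}$, acting on the B-type Fock space $\mathcal F_B$ of formal (possibly infinite) sums of the vectors $\phi_{k_1}\cdots\phi_{k_r}|0\rangle$, $k_1>\cdots>k_r\ge 0$, where $\phi_i|0\rangle=0$ for $i<0$; let $\langle 0|$ be the dual vacuum ($\langle 0|\phi_i=0$ for $i>0$, $\langle0|0\rangle=1$, $\langle 0|\phi_0|0\rangle=0$), let $:\!\phi_i\phi_j\!:\;=\phi_i\phi_j-\langle0|\phi_i\phi_j|0\rangle$ and $\phi(z)=\sum_{i\in\mathbb Z}\phi_iz^i$. Let $|V\rangle$ be a fermionic tau-function of the BKP hierarchy in the big cell, i.e. a vector in the even part of $\mathcal F_B$ with $\langle 0|V\rangle\neq 0$ that satisfies the BKP bilinear identity $$\sum_{j\in\mathbb Z}(-1)^j\phi_j|V\rangle\otimes\phi_{-j}|V\rangle=R|V\rangle\otimes R|V\rangle ,$$ where $R$ is the operator $a|0\rangle\mapsto a\phi_0|0\rangle$ ($a$ a product of fermions). Put $$\Psi^B(z)=\frac{\langle0|\phi_0\phi(z)|V\rangle}{\langle0|V\rangle},\qquad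 \tilde\Psi^B(z)=\frac{\langle0|\phi_{-1}\phi(z)|V\rangle}{\langle0|V\rangle},\qquad \Psi^B(u,v)=\frac{\langle0|\phi(u)\phi(v)|V\rangle}{\langle0|V\rangle},$$ as formal series infinite in both directions. Let $w_{1+\infty}=\mathrm{span}_{\mathbb C}\{z^i\partial_z^j: i\in\mathbb Z,\ j\ge0\}$, where $z^i\partial_z^j$ has energy $i-j$, let $\iota$ be the involution $\iota(z^k(z\partial_z)^m)=(-z\partial_z)^m(-z)^k$, let $\tilde l=\frac12(l-\iota(l))$ be the anti-symmetrization of $l\in w_{1+\infty}$, and let $\hat l^B=\frac12\mathrm{Res}_w\,w^{-1}:\!\phi(z)\,l_w\phi(w)\!:|_{z=-w}$ be its fermionic realization. Let $l\in w_{1+\infty}$ be a lifting operator of B-type for $|V\rangle$, that is: 1. $l$ is the sum of a part of energy one and terms of non-positive energy; 2. $l$ is a Kac–Schwarz operator of $|V\rangle$: $\hat l^B|V\rangle=c_l|V\rangle$ for some $c_l\in\mathbb C$; 3. the coefficient of $z$ in $\tilde l$, written in the basis $z^i\partial_z^j$, equals $1$. (If $\iota(l)=-l$, or if the energy-one part of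 $l$ is a multiple of $z$, this says that the coefficient of $z$ in $l$ is $1$.) Then $$(\tilde l_u+\tilde l_v)\cdot\Psi^B(u,v)=\Psi^B(u)\tilde\Psi^B(v)-\Psi^B(v)\tilde\Psi^B(u).$$ -/

import Mathlib

namespace BKP

noncomputable section

/-! ### Neutral fermions and the (completed) B-type Fock space -/

/-- The B-type fermionic Fock space: formal (possibly infinite) sums `∑ c_S e_S`, where for a finite
set `S = {k₁ > ⋯ > k_r}` of non-negative integers `e_S = φ_{k₁} ⋯ φ_{k_r} |0⟩`. A vector is its
family of coefficients. -/
abbrev Fock : Type := Finset ℕ → ℂ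

/-- The vacuum `|0⟩ = e_∅`. -/
def vac : Fock := Pi.single ∅ 1

/-- The pairing `⟨0|V⟩`, i.e. the coefficient of `|0⟩` in `V`. -/
def vev (V : Fock) : ℂ := V ∅

/-- The sign `(-1)^{#{t ∈ T : t > k}}` of moving `φ_{±k}` past the larger factors of `e_T`. -/
def koszulSign (k : ℕ) (T : Finset ℕ) : ℂ := (-1) ^ (T.filter (fun t => k < t)).card

/-- The operator with `e_S ↦ ± e_{S ∪ {k}}` if `k ∉ S`, and `e_S ↦ 0` if `k ∈ S`. -/
def create (k : ℕ) : Fock →ₗ[ℂ] Fock where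
  toFun V := fun T => if k ∈ T then koszulSign k T * V (T.erase k) else 0
  map_add' V W := by
    funext T
    by_cases h : k ∈ T <;> simp [h, mul_add]
  map_smul' c V := by
    funext T
    by_cases h : k ∈ T <;> simp [h, mul_left_comm]

/-- The operator with `e_S ↦ ± e_{S \ {k}}` if `k ∈ S`, and `e_S ↦ 0` if `k ∉ S`. -/
def annihilate (k : ℕ) : Fock →ₗ[ℂ] Fock where
  toFun V := fun T => if k ∈ T then 0 else koszulSign k T * V (insert k T)
  map_add' V W := by
    funext T
    by_cases h : k ∈ T <;> simp [h, mul_add]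
  map_smul' c V := by
    funext T
    by_cases h : k ∈ T <;> simp [h, mul_left_comm]

/-- The neutral fermion `φ_i`, `i ∈ ℤ`, acting on the Fock space. This is the representation
determined by `φ_i φ_j + φ_j φ_i = (-1)^i δ_{i+j,0}` (so `φ_0² = 1/2`) and `φ_i |0⟩ = 0` for
`i < 0`. -/
def phi (i : ℤ) : Fock →ₗ[ℂ] Fock :=
  if 0 < i then create i.natAbs
  else if i < 0 then ((-1 : ℂ) ^ i.natAbs) • annihilate i.natAbs
  else create 0 + (1 / 2 : ℂ) • annihilate 0

/-- The normally ordered product `:φ_i φ_j: = φ_i φ_j - ⟨0|φ_i φ_j|0⟩`. -/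
def normalOrdered (i j : ℤ) : Fock →ₗ[ℂ] Fock :=
  phi i * phi j - vev (phi i (phi j vac)) • 1

/-- The even part `F_B^{(0)}` of the Fock space (sums of products of an even number of fermions
applied to the vacuum). -/
def evenFock : Submodule ℂ Fock where
  carrier := {V | ∀ S : Finset ℕ, Odd S.card → V S = 0}
  add_mem' := by
    intro V W hV hW S hS
    simp [hV S hS, hW S hS]
  zero_mem' := by
    intro S _
    rfl
  smul_mem' := by
    intro c V hV S hS
    simp [hV S hS]

/-- The operator `a|0⟩ ↦ a φ_0 |0⟩`: it sends `e_S` to `e_{S ∪ {0}}` if `0 ∉ S` and to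
`(1/2) e_{S \ {0}}` if `0 ∈ S`. -/
def rightPhiZero (V : Fock) : Fock :=
  fun T => if 0 ∈ T then V (T.erase 0) else (1 / 2 : ℂ) * V (insert 0 T)

/-- The Hirota bilinear identity of the BKP hierarchy in fermionic form,
`∑_{j ∈ ℤ} (-1)^j φ_j V ⊗ φ_{-j} V = V' ⊗ V'` with `V' = g φ_0 |0⟩` for `V = g |0⟩`,
written out on the coefficients of `e_S ⊗ e_T` (for given `S, T` only finitely many summands are
non-zero). -/
def SatisfiesBKP (V : Fock) : Prop :=
  ∀ S T : Finset ℕ,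
    ∑ᶠ j : ℤ, (-1 : ℂ) ^ j * (phi j V S * phi (-j) V T) = rightPhiZero V S * rightPhiZero V T

/-- `V` is a fermionic tau-function of the BKP hierarchy in the big cell. -/
structure IsBigCellTau (V : Fock) : Prop where
  even : V ∈ evenFock
  bilinear : SatisfiesBKP V
  bigCell : vev V ≠ 0

/-! ### The algebra `w_{1+∞}` of differential operators on the circle -/

/-- Formal series `∑_{n ∈ ℤ} f_n z^n`, infinite in both directions. -/
abbrev Series : Type := ℤ → ℂ

/-- Formal series `∑_{m,n ∈ ℤ} F_{m,n} u^m v^n`. -/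
abbrev Series₂ : Type := ℤ → ℤ → ℂ

/-- The operators `∑_k z^k p_k(z∂_z)`, a finite sum over `k ∈ ℤ` with polynomials `p_k`. They are
the linear combinations of the `z^i ∂_z^j`, `i ∈ ℤ`, `j ≥ 0`: as
`z^i ∂_z^j = z^{i-j} D (D-1) ⋯ (D-j+1)` with `D = z∂_z`, the component `z^k p_k(D)` collects the
terms with `i - j = k`, that is, the part of energy `k`. -/
abbrev DiffOp : Type := ℤ →₀ Polynomial ℂ

/-- Multiplication by `z^k`. -/
def mulZ (k : ℤ) : Module.End ℂ Series where
  toFun f := fun n => f (n - k)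
  map_add' _ _ := rfl
  map_smul' _ _ := rfl

/-- The Euler operator `D = z∂_z`. -/
def euler : Module.End ℂ Series where
  toFun f := fun n => (n : ℂ) * f n
  map_add' f g := by
    funext n
    simp [mul_add]
  map_smul' c f := by
    funext n
    simp [mul_left_comm]

/-- The action of an operator on formal series in `z`. -/
def DiffOp.act (l : DiffOp) : Module.End ℂ Series :=
  l.sum fun k p => mulZ k * Polynomial.aeval euler p

/-- `l_u`: the action on the first variable. -/
def DiffOp.actFst (l : DiffOp) (F : Series₂) : Series₂ :=
  fun m n => l.act (fun i => F i n) m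

/-- `l_v`: the action on the second variable. -/
def DiffOp.actSnd (l : DiffOp) (F : Series₂) : Series₂ :=
  fun m n => l.act (F m) n

/-- The involution with `ι(z^k p(D)) = p(-D) (-z)^k`; in normal form the right-hand side is
`(-1)^k z^k p(-(D + k))`. -/
def iota (l : DiffOp) : DiffOp :=
  l.sum fun k p =>
    Finsupp.single k
      (Polynomial.C ((-1 : ℂ) ^ k) * p.comp (-(Polynomial.X + Polynomial.C (k : ℂ))))

/-- `ι(z^k D^m) = (-D)^m (-z)^k` as operators. -/
theorem iota_spec (k : ℤ) (m : ℕ) :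
    (iota (Finsupp.single k (Polynomial.X ^ m))).act
      = (-euler) ^ m * (((-1 : ℂ) ^ k) • mulZ k) := by
  have hE : ∀ (p : Polynomial ℂ) (f : Series) (n : ℤ),
      Polynomial.aeval euler p f n = p.eval (n : ℂ) * f n := by
    intro p
    induction p using Polynomial.induction_on' with
    | add p q hp hq =>
      intro f n
      simp [hp, hq, add_mul]
    | monomial r a =>
      intro f n
      have : ∀ r : ℕ, (euler ^ r) f n = (n : ℂ) ^ r * f n := by
        intro r
        induction r with
        | zero => simp
        | succ r ih =>
          rw [pow_succ', Module.End.mul_apply]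
          simp only [euler, LinearMap.coe_mk, AddHom.coe_mk] at ih ⊢
          rw [ih]
          ring
      simp [Polynomial.aeval_monomial, this, mul_assoc, Module.algebraMap_end_apply]
  have hN : ∀ (r : ℕ) (f : Series) (n : ℤ), ((-euler) ^ r) f n = (-(n : ℂ)) ^ r * f n := by
    intro r
    induction r with
    | zero => simp
    | succ r ih =>
      intro f n
      rw [pow_succ, Module.End.mul_apply, ih]
      simp only [LinearMap.neg_apply, Pi.neg_apply, euler, LinearMap.coe_mk, AddHom.coe_mk]
      ring
  refine LinearMap.ext fun f => funext fun n => ?_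
  rw [iota, Finsupp.sum_single_index (by simp), DiffOp.act, Finsupp.sum_single_index (by simp),
    Module.End.mul_apply, Module.End.mul_apply, hN]
  simp only [mulZ, LinearMap.coe_mk, AddHom.coe_mk, LinearMap.smul_apply, Pi.smul_apply,
    smul_eq_mul, hE]
  simp only [Polynomial.eval_mul, Polynomial.eval_C, Polynomial.eval_comp, Polynomial.eval_pow,
    Polynomial.eval_neg, Polynomial.eval_add, Polynomial.eval_X]
  push_cast
  rw [show (-((n : ℂ) - k + k)) = -(n : ℂ) by ring]
  ring

/-- The anti-symmetrization `l̃ = (l - ι(l)) / 2`. -/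
def antisymm (l : DiffOp) : DiffOp := (1 / 2 : ℂ) • (l - iota l)

/-- The coefficient of `z` when `l` is written as a linear combination of the `z^k (z∂_z)^m`
(equivalently, of the `z^i ∂_z^j`). -/
def zCoeff (l : DiffOp) : ℂ := (l 1).eval 0

/-- `l` consists of a part of energy one and parts of non-positive energy. -/
def EnergyLeOne (l : DiffOp) : Prop := ∀ k : ℤ, 1 < k → l k = 0

/-- The fermionic realization `(1/2) Res_w w⁻¹ :φ(z) l_w φ(w):|_{z = -w}` of `l`, acting on the Fock
space. For `l = z^k p(D)` one has `l_w φ(w) = ∑_j p(j) φ_j w^{j+k}` and `φ(-w) = ∑_i (-1)^i φ_i w^i`;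
the coefficient of `w^0` of the product comes from `i = -j-k`. On a coefficient of `e_T` only
finitely many `j` contribute. -/
def hatB (l : DiffOp) (V : Fock) : Fock :=
  fun T => (1 / 2 : ℂ) * l.sum fun k p =>
    ∑ᶠ j : ℤ, (-1 : ℂ) ^ (-j - k) * p.eval (j : ℂ) * normalOrdered (-j - k) j V T

/-- `l` is a Kac–Schwarz operator of `V`: `V` is an eigenvector of the realization of `l`. -/
def IsKacSchwarz (l : DiffOp) (V : Fock) : Prop := ∃ c : ℂ, hatB l V = c • V

/-- `l` is a lifting operator of B-type for `V`. The realization of `l` depends only on the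
anti-symmetrization of `l`, and the normalization is imposed there; if `ι(l) = -l`, or if the energy
one part of `l` is a multiple of `z`, it says that the coefficient of `z` in `l` is one. -/
structure IsLiftingOperator (l : DiffOp) (V : Fock) : Prop where
  energy : EnergyLeOne l
  kacSchwarz : IsKacSchwarz l V
  normalized : zCoeff (antisymm l) = 1

/-! ### Fermionic one- and two-point functions -/

/-- First fermionic one-point function `Ψ^B(z) = ⟨0|φ_0 φ(z)|V⟩ / ⟨0|V⟩`, with
`φ(z) = ∑_n φ_n z^n`. -/
def onePoint (V : Fock) : Series := fun n => vev (phi 0 (phi n V)) / vev V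

/-- Second fermionic one-point function `⟨0|φ_{-1} φ(z)|V⟩ / ⟨0|V⟩`. -/
def onePoint' (V : Fock) : Series := fun n => vev (phi (-1) (phi n V)) / vev V

/-- Fermionic two-point function `Ψ^B(u,v) = ⟨0|φ(u) φ(v)|V⟩ / ⟨0|V⟩`. -/
def twoPoint (V : Fock) : Series₂ := fun m n => vev (phi m (phi n V)) / vev V

end

end BKP

/-! Write `l̃` for `antisymm l` and `⟨X⟩` for `vev (X V)`. Commuting the fermionic realization of
`l` with `φ(z)` gives minus the action of `l̃` on `φ(z)`, so carrying it from `|V⟩` leftwards past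
`φ(u)φ(v)` makes `l̃_u + l̃_v` act on the two-point function. At the right end the Kac–Schwarz
condition replaces it by the scalar `c`. At the left end, since the energy is at most one, only `φ_0
φ_{-1}` survives against `⟨0|`, with coefficient `zCoeff (antisymm l) = 1`. Hence `(l̃_u + l̃_v)
⟨φ_m φ_n⟩ = c ⟨φ_m φ_n⟩ - ⟨φ_0 φ_{-1} φ_m φ_n⟩` (`actFst_add_actSnd_twoPoint`), and without the two
fermions `c ⟨1⟩ = ⟨φ_0 φ_{-1}⟩` (`vev_smul_of_hatB`).

The bilinear identity yields Wick's theorem for four fermions (`SatisfiesBKP.wick`). Of the three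
pairings of `⟨φ_0 φ_{-1} φ_m φ_n⟩`, the one containing `⟨φ_0 φ_{-1}⟩` cancels the eigenvalue term,
and the other two are the right-hand side.

The infinite sums over modes converge only coefficientwise. They are handled by truncating to `|j| ≤
N` and pairing with functionals of finitely many coefficients (`finiteDual`), for which the
truncation is exact once `N` is large. -/

namespace BKP

/-! ### Canonical anticommutation relations -/

/-- The coefficient of `φ_i` on the basis vectors obtained by creating `|i|`. -/
noncomputable def upCoeff (i : ℤ) : ℂ := if 0 ≤ i then 1 else 0

/-- The coefficient of `φ_i` on the basis vectors obtained by annihilating `|i|`. -/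
noncomputable def downCoeff (i : ℤ) : ℂ :=
  if 0 < i then 0 else if i < 0 then (-1) ^ i.natAbs else 1 / 2

/-- Add `k` to `T` if it is absent, remove it if it is present. -/
def toggle (k : ℕ) (T : Finset ℕ) : Finset ℕ := if k ∈ T then T.erase k else insert k T

theorem mem_toggle_self (k : ℕ) (T : Finset ℕ) : k ∈ toggle k T ↔ k ∉ T := by
  unfold toggle; split_ifs with h <;> simp [h]

theorem mem_toggle_of_ne {k m : ℕ} (h : m ≠ k) (T : Finset ℕ) : m ∈ toggle k T ↔ m ∈ T := by
  unfold toggle; split_ifs <;> simp [h]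

theorem toggle_toggle (k : ℕ) (T : Finset ℕ) : toggle k (toggle k T) = T := by
  ext m
  by_cases h : m = k
  · subst h; simp [mem_toggle_self]
  · simp [mem_toggle_of_ne h]

theorem toggle_comm (k m : ℕ) (T : Finset ℕ) : toggle k (toggle m T) = toggle m (toggle k T) := by
  by_cases hkm : k = m
  · rw [hkm]
  ext x
  by_cases h : x = k
  · subst h; simp [mem_toggle_self, mem_toggle_of_ne hkm]
  · by_cases h' : x = m
    · subst h'; simp [mem_toggle_self, mem_toggle_of_ne h]
    · simp [mem_toggle_of_ne h, mem_toggle_of_ne h']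

theorem koszulSign_mul_self (k : ℕ) (T : Finset ℕ) : koszulSign k T * koszulSign k T = 1 := by
  unfold koszulSign
  rw [← mul_pow]; simp

theorem koszulSign_toggle_of_le {k m : ℕ} (h : m ≤ k) (T : Finset ℕ) :
    koszulSign k (toggle m T) = koszulSign k T := by
  unfold koszulSign
  congr 2
  ext x
  simp only [Finset.mem_filter]
  constructor <;> rintro ⟨h1, h2⟩ <;> refine ⟨?_, h2⟩
  · rwa [mem_toggle_of_ne (by omega)] at h1
  · rwa [mem_toggle_of_ne (by omega)]

/-- The source of anticommutation for distinct modes: toggling the larger mode flips the sign of the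
smaller one, but not conversely. -/
theorem koszulSign_toggle_of_lt {k m : ℕ} (h : k < m) (T : Finset ℕ) :
    koszulSign k (toggle m T) = -koszulSign k T := by
  unfold koszulSign toggle
  split_ifs with hm
  · have : T.filter (fun t => k < t) = insert m ((T.erase m).filter (fun t => k < t)) := by
      ext x; simp only [Finset.mem_filter, Finset.mem_insert, Finset.mem_erase]
      by_cases hx : x = m
      · subst hx; simp [hm, h]
      · simp [hx]
    rw [this, Finset.card_insert_of_notMem (by simp), pow_succ]
    ring
  · rw [Finset.filter_insert, if_pos h, Finset.card_insert_of_notMem (by simp [hm]), pow_succ]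
    ring

/-- One formula for creation, annihilation and the mixed mode `φ_0`: every mode is a weighted,
signed toggle, so products of modes reduce to sign bookkeeping. -/
theorem phi_apply (i : ℤ) (W : Fock) (T : Finset ℕ) :
    phi i W T = koszulSign i.natAbs T *
      (if i.natAbs ∈ T then upCoeff i else downCoeff i) * W (toggle i.natAbs T) := by
  rcases lt_trichotomy i 0 with h | h | h
  · have h1 : ¬ 0 < i := by omega
    have h2 : ¬ 0 ≤ i := by omega
    by_cases hT : i.natAbs ∈ T
    · simp [phi, annihilate, upCoeff, h, h1, h2, hT]
    · simp [phi, annihilate, downCoeff, toggle, h, h1, hT]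
      ring
  · subst h
    by_cases hT : 0 ∈ T
    · simp [phi, annihilate, create, upCoeff, toggle, hT]
    · simp [phi, annihilate, create, downCoeff, toggle, hT]
      ring
  · have h2 : 0 ≤ i := h.le
    by_cases hT : i.natAbs ∈ T
    · simp [phi, create, upCoeff, toggle, h, h2, hT]
    · simp [phi, create, downCoeff, h, hT]

theorem phi_apply_of_pos {i : ℤ} (hi : 0 < i) (W : Fock) {T : Finset ℕ} (hT : i.natAbs ∉ T) :
    phi i W T = 0 := by
  simp [phi, create, hi, hT]

theorem neg_one_zpow_mul_self (n : ℤ) : (-1 : ℂ) ^ n * (-1) ^ n = 1 := by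
  rw [← mul_zpow]; simp

/-- The value of the anticommutator `φ_i φ_j + φ_j φ_i`. -/
noncomputable def anticomm (i j : ℤ) : ℂ := if i + j = 0 then (-1) ^ i else 0

/-- If `|i| = |j|`, the two toggles undo each other, the signs square to one and only the up and
down coefficients matter. Otherwise exactly one of the two signs flips under the other toggle, and
the products cancel. -/
theorem phi_anticomm (i j : ℤ) (W : Fock) :
    phi i (phi j W) + phi j (phi i W) = anticomm i j • W := by
  funext T
  simp only [Pi.add_apply, Pi.smul_apply, smul_eq_mul, phi_apply]
  by_cases hij : i.natAbs = j.natAbs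
  · rw [hij, toggle_toggle, koszulSign_toggle_of_le le_rfl]
    simp only [mem_toggle_self]
    have key : (if j.natAbs ∈ T then upCoeff i else downCoeff i) *
          (if j.natAbs ∉ T then upCoeff j else downCoeff j) +
        (if j.natAbs ∈ T then upCoeff j else downCoeff j) *
          (if j.natAbs ∉ T then upCoeff i else downCoeff i) = anticomm i j := by
      have : upCoeff i * downCoeff j + upCoeff j * downCoeff i = anticomm i j := by
        have hz : ∀ n : ℤ, (-1 : ℂ) ^ n.natAbs = (-1) ^ n := by
          intro n
          rcases Int.natAbs_eq n with h | h
          · conv_rhs => rw [h, zpow_natCast]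
          · conv_rhs => rw [h]
            rw [zpow_neg, zpow_natCast, ← inv_pow]
            norm_num
        simp only [upCoeff, downCoeff, anticomm, hz]
        rcases Int.natAbs_eq_natAbs_iff.1 hij with h | h
        · subst h
          rcases lt_trichotomy i 0 with h | h | h
          · simp [show ¬ 0 ≤ i by omega]; omega
          · subst h; norm_num
          · simp [h]; omega
        · subst h
          rcases lt_trichotomy j 0 with h | h | h
          · simp [h, show ¬ 0 ≤ j by omega, h.le, h.not_gt]
            exact eq_inv_of_mul_eq_one_left (neg_one_zpow_mul_self j)
          · subst h; norm_num
          · simp [h, h.le, h.not_gt]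
      rw [← this]
      split_ifs <;> ring
    rw [← key]
    linear_combination ((if j.natAbs ∈ T then upCoeff i else downCoeff i) *
          (if j.natAbs ∉ T then upCoeff j else downCoeff j) +
        (if j.natAbs ∈ T then upCoeff j else downCoeff j) *
          (if j.natAbs ∉ T then upCoeff i else downCoeff i)) * W T *
        koszulSign_mul_self j.natAbs T
  · have h0 : anticomm i j = 0 := by
      rw [anticomm, if_neg]; omega
    rw [h0, toggle_comm j.natAbs]
    simp only [mem_toggle_of_ne hij, mem_toggle_of_ne (Ne.symm hij)]
    rcases lt_or_gt_of_ne hij with h | h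
    · rw [koszulSign_toggle_of_lt h, koszulSign_toggle_of_le h.le]
      ring
    · rw [koszulSign_toggle_of_lt h, koszulSign_toggle_of_le h.le]
      ring

theorem phi_phi (i j : ℤ) (W : Fock) :
    phi i (phi j W) = anticomm i j • W - phi j (phi i W) :=
  eq_sub_of_add_eq (phi_anticomm i j W)

theorem phi_zero_phi_zero (W : Fock) : phi 0 (phi 0 W) = (1 / 2 : ℂ) • W := by
  have h := phi_anticomm 0 0 W
  rw [← two_smul ℂ, anticomm] at h
  rw [if_pos (add_zero 0), zpow_zero, one_smul] at h
  rw [eq_comm, one_div, inv_smul_eq_iff₀ two_ne_zero, h]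

theorem phi_vac_of_neg {i : ℤ} (hi : i < 0) : phi i vac = 0 := by
  funext T
  rw [phi_apply]
  by_cases hT : i.natAbs ∈ T
  · simp [hT, upCoeff, show ¬ 0 ≤ i by omega]
  · have : toggle i.natAbs T ≠ ∅ := by
      intro h
      have := (mem_toggle_self i.natAbs T).2 hT
      simp [h] at this
    simp [vac, this]

/-- The pairing with `⟨0|` as a linear functional. -/
def vevLinear : Fock →ₗ[ℂ] ℂ := LinearMap.proj ∅

theorem vevLinear_apply (W : Fock) : vevLinear W = vev W := rfl

theorem vev_sub (V W : Fock) : vev (V - W) = vev V - vev W := rfl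

theorem vev_smul (c : ℂ) (W : Fock) : vev (c • W) = c * vev W := rfl

theorem vev_vac : vev vac = 1 := by simp [vev, vac]

theorem vev_phi_of_pos {i : ℤ} (hi : 0 < i) (W : Fock) : vev (phi i W) = 0 :=
  phi_apply_of_pos hi W (by simp)

/-! ### Normal ordering -/

theorem normalOrdered_apply (i j : ℤ) (W : Fock) :
    normalOrdered i j W = phi i (phi j W) - vev (phi i (phi j vac)) • W := rfl

theorem normalOrdered_of_left_pos {i : ℤ} (hi : 0 < i) (j : ℤ) (W : Fock) :
    normalOrdered i j W = phi i (phi j W) := by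
  rw [normalOrdered_apply, vev_phi_of_pos hi, zero_smul, sub_zero]

/-- Normal ordering absorbs the anticommutator, so the creating mode can stand leftmost, where `⟨0|`
kills it. -/
theorem normalOrdered_of_right_pos (i : ℤ) {j : ℤ} (hj : 0 < j) (W : Fock) :
    normalOrdered i j W = -phi j (phi i W) := by
  rw [normalOrdered_apply, phi_phi i j W, phi_phi i j vac, vev_sub, vev_smul, vev_vac,
    vev_phi_of_pos hj]
  simp

theorem normalOrdered_zero_zero (W : Fock) : normalOrdered 0 0 W = 0 := by
  rw [normalOrdered_apply, phi_zero_phi_zero, phi_zero_phi_zero, vev_smul, vev_vac]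
  simp

theorem normalOrdered_zero_neg_one (W : Fock) : normalOrdered 0 (-1) W = phi 0 (phi (-1) W) := by
  rw [normalOrdered_apply, phi_vac_of_neg (by norm_num : (-1 : ℤ) < 0)]
  simp [vev]

theorem normalOrdered_neg_one_zero (W : Fock) : normalOrdered (-1) 0 W = -phi 0 (phi (-1) W) := by
  rw [normalOrdered_apply, phi_phi (-1) 0, phi_phi (-1) 0,
    phi_vac_of_neg (by norm_num : (-1 : ℤ) < 0)]
  simp [vev, anticomm]

/-- In energy at least zero, only the pairing of `φ_i φ_j` with `i, j ≤ 0` could survive, and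
normal ordering removes it. -/
theorem vev_normalOrdered_of_nonneg {i j : ℤ} (h : 0 ≤ i + j) (W : Fock) :
    vev (normalOrdered i j W) = 0 := by
  by_cases hi : 0 < i
  · rw [normalOrdered_of_left_pos hi, vev_phi_of_pos hi]
  by_cases hj : 0 < j
  · rw [normalOrdered_of_right_pos i hj, ← neg_one_smul ℂ, vev_smul, vev_phi_of_pos hj, mul_zero]
  obtain rfl : i = 0 := by omega
  obtain rfl : j = 0 := by omega
  rw [normalOrdered_zero_zero]; rfl

theorem normalOrdered_phi (i j n : ℤ) (W : Fock) :
    normalOrdered i j (phi n W) = phi n (normalOrdered i j W)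
      + anticomm j n • phi i W - anticomm i n • phi j W := by
  simp only [normalOrdered_apply, map_sub, map_smul]
  rw [phi_phi j n W, map_sub, map_smul, phi_phi i n (phi j W)]
  abel

/-! ### Functionals of finitely many coefficients -/

/-- The linear functionals on the Fock space that depend on finitely many coefficients. -/
def finiteDual : Submodule ℂ (Module.Dual ℂ Fock) :=
  Submodule.span ℂ (Set.range fun T : Finset ℕ => (LinearMap.proj T : Module.Dual ℂ Fock))

theorem vevLinear_mem : vevLinear ∈ finiteDual := Submodule.subset_span ⟨∅, rfl⟩

/-- Each coefficient of `φ_i W` reads a single coefficient of `W`. Thus functionals such as `⟨0|φ_m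
φ_n` remain finite. -/
theorem comp_phi_mem {f : Module.Dual ℂ Fock} (hf : f ∈ finiteDual) (i : ℤ) :
    f ∘ₗ phi i ∈ finiteDual := by
  induction hf using Submodule.span_induction with
  | mem f hf =>
    obtain ⟨T, rfl⟩ := hf
    have : (LinearMap.proj T : Module.Dual ℂ Fock) ∘ₗ phi i =
        (koszulSign i.natAbs T * (if i.natAbs ∈ T then upCoeff i else downCoeff i)) •
          LinearMap.proj (toggle i.natAbs T) :=
      LinearMap.ext fun W => phi_apply i W T
    rw [this]
    exact Submodule.smul_mem _ _ (Submodule.subset_span ⟨_, rfl⟩)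
  | zero => simp
  | add f g _ _ hf hg => rw [LinearMap.add_comp]; exact add_mem hf hg
  | smul c f _ hf => rw [LinearMap.smul_comp]; exact Submodule.smul_mem _ _ hf

/-! ### Truncations of the fermionic realization -/

open Filter

/-- The fermionic realization of `l` with the sum over `j` truncated to `|j| ≤ N`. -/
noncomputable def hatBTrunc (N : ℕ) (l : DiffOp) : Fock →ₗ[ℂ] Fock :=
  (1 / 2 : ℂ) • l.sum fun k p =>
    ∑ j ∈ Finset.Icc (-(N : ℤ)) N,
      ((-1 : ℂ) ^ (-j - k) * p.eval (j : ℂ)) • normalOrdered (-j - k) j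

theorem hatBTrunc_apply (N : ℕ) (l : DiffOp) (W : Fock) :
    hatBTrunc N l W = (1 / 2 : ℂ) • l.sum fun k p =>
      ∑ j ∈ Finset.Icc (-(N : ℤ)) N,
        ((-1 : ℂ) ^ (-j - k) * p.eval (j : ℂ)) • normalOrdered (-j - k) j W := by
  simp [hatBTrunc, Finsupp.sum, LinearMap.sum_apply]

theorem exists_natAbs_notMem (T : Finset ℕ) : ∃ B : ℕ, ∀ i : ℤ, (B : ℤ) < i → i.natAbs ∉ T :=
  ⟨T.sup id, fun i hi h => by
    have : i.natAbs ≤ T.sup id := Finset.le_sup (f := id) h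
    omega⟩

theorem eventually_finsum_eq_sum_Icc {f : ℤ → ℂ} {B : ℕ} (hf : ∀ j : ℤ, (B : ℤ) < |j| → f j = 0) :
    ∀ᶠ N : ℕ in atTop, ∑ᶠ j, f j = ∑ j ∈ Finset.Icc (-(N : ℤ)) N, f j := by
  filter_upwards [eventually_ge_atTop B] with N hN
  refine finsum_eq_sum_of_support_subset _ fun j hj => ?_
  by_contra h
  refine hj (hf j ?_)
  rw [Finset.mem_coe, Finset.mem_Icc, ← abs_le] at h
  omega

theorem eventually_hatB_eq (l : DiffOp) (V : Fock) (T : Finset ℕ) :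
    ∀ᶠ N in atTop, hatB l V T = hatBTrunc N l V T := by
  obtain ⟨B, hB⟩ := exists_natAbs_notMem T
  have key : ∀ k ∈ l.support, ∀ᶠ N : ℕ in atTop,
      ∑ᶠ j : ℤ, (-1 : ℂ) ^ (-j - k) * (l k).eval (j : ℂ) * normalOrdered (-j - k) j V T
        = ∑ j ∈ Finset.Icc (-(N : ℤ)) N,
          (-1 : ℂ) ^ (-j - k) * (l k).eval (j : ℂ) * normalOrdered (-j - k) j V T := by
    intro k _
    -- Beyond this bound either `j` or `-j - k` exceeds `B`; that mode can be placed leftmost and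
    -- would have to create an element absent from `T`.
    refine eventually_finsum_eq_sum_Icc (B := B + k.natAbs) fun j hj => ?_
    rw [Nat.cast_add] at hj
    rw [mul_eq_zero]
    right
    rcases lt_abs.1 hj with h | h
    · have hj : 0 < j := by omega
      rw [normalOrdered_of_right_pos _ hj, Pi.neg_apply,
        phi_apply_of_pos hj _ (hB j (by omega)), neg_zero]
    · have hj : 0 < -j - k := by omega
      rw [normalOrdered_of_left_pos hj, phi_apply_of_pos hj _ (hB _ (by omega))]
  filter_upwards [(eventually_all_finset _).2 key] with N hN
  rw [hatBTrunc_apply, hatB]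
  simp only [Finsupp.sum, Pi.smul_apply, Finset.sum_apply, smul_eq_mul]
  congr 1
  exact Finset.sum_congr rfl hN

theorem eventually_dual_hatB_eq (l : DiffOp) (V : Fock) {f : Module.Dual ℂ Fock}
    (hf : f ∈ finiteDual) : ∀ᶠ N in atTop, f (hatB l V) = f (hatBTrunc N l V) := by
  induction hf using Submodule.span_induction with
  | mem f hf =>
    obtain ⟨T, rfl⟩ := hf
    exact eventually_hatB_eq l V T
  | zero => simp
  | add f g _ _ hf hg =>
    filter_upwards [hf, hg] with N h1 h2
    simp [h1, h2]
  | smul c f _ hf =>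
    filter_upwards [hf] with N h
    simp [h]

/-! ### The action of differential operators -/

theorem aeval_euler_apply (p : Polynomial ℂ) (f : Series) (n : ℤ) :
    Polynomial.aeval euler p f n = p.eval (n : ℂ) * f n := by
  induction p using Polynomial.induction_on' with
  | add p q hp hq => simp [hp, hq, add_mul]
  | monomial r a =>
    have : ∀ r : ℕ, (euler ^ r) f n = (n : ℂ) ^ r * f n := by
      intro r
      induction r with
      | zero => simp
      | succ r ih =>
        rw [pow_succ', Module.End.mul_apply]
        simp only [euler, LinearMap.coe_mk, AddHom.coe_mk] at ih ⊢
        rw [ih]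
        ring
    simp [Polynomial.aeval_monomial, this, mul_assoc, Module.algebraMap_end_apply]

theorem DiffOp.act_apply (l : DiffOp) (f : Series) (n : ℤ) :
    l.act f n = l.sum fun k p => p.eval ((n - k : ℤ) : ℂ) * f (n - k) := by
  simp only [DiffOp.act, Finsupp.sum, LinearMap.sum_apply, Finset.sum_apply]
  refine Finset.sum_congr rfl fun k _ => ?_
  rw [Module.End.mul_apply]
  exact aeval_euler_apply _ _ _

theorem iota_apply (l : DiffOp) (k : ℤ) :
    iota l k = Polynomial.C ((-1 : ℂ) ^ k) *
      (l k).comp (-(Polynomial.X + Polynomial.C (k : ℂ))) := by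
  rw [iota, Finsupp.sum, Finsupp.finsetSum_apply, Finset.sum_eq_single k]
  · simp
  · intro m _ hm
    simp [hm]
  · intro hk
    simp [Finsupp.notMem_support_iff.1 hk]

theorem antisymm_apply_eval (l : DiffOp) (k : ℤ) (x : ℂ) :
    (antisymm l k).eval x = 1 / 2 * ((l k).eval x - (-1) ^ k * (l k).eval (-(x + k))) := by
  simp [antisymm, iota_apply]

/-- Puts the action in the shape produced by the commutator with `φ_n`. The argument `-n` arises
from `-(D + k)` evaluated on `z^(n - k)`. -/
theorem antisymm_act_apply (l : DiffOp) (f : Series) (n : ℤ) :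
    (antisymm l).act f n = (1 / 2 : ℂ) * l.sum fun k p =>
      (p.eval ((n - k : ℤ) : ℂ) - (-1) ^ k * p.eval (-(n : ℂ))) * f (n - k) := by
  have hsub : (antisymm l).support ⊆ l.support := by
    intro k hk
    rw [Finsupp.mem_support_iff] at hk ⊢
    contrapose! hk
    simp [antisymm, iota_apply, hk]
  rw [DiffOp.act_apply, Finsupp.sum_of_support_subset _ hsub _ (by simp), Finsupp.sum,
    Finset.mul_sum]
  refine Finset.sum_congr rfl fun k _ => ?_
  rw [antisymm_apply_eval]
  push_cast
  rw [sub_add_cancel]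
  ring

/-! ### The action of the fermionic realization -/

theorem eventually_mem_Icc (a : ℤ) : ∀ᶠ N : ℕ in atTop, a ∈ Finset.Icc (-(N : ℤ)) N := by
  filter_upwards [eventually_ge_atTop a.natAbs] with N hN
  rw [Finset.mem_Icc]
  omega

/-- The commutator of the fermionic realization with `φ_n`. -/
theorem eventually_hatBTrunc_phi (l : DiffOp) (n : ℤ) :
    ∀ᶠ N in atTop, ∀ W : Fock, hatBTrunc N l (phi n W) = phi n (hatBTrunc N l W)
      - (1 / 2 : ℂ) • l.sum fun k p =>
        (p.eval ((n - k : ℤ) : ℂ) - (-1) ^ k * p.eval (-(n : ℂ))) • phi (n - k) W := by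
  -- In energy `k` only `j = -n` and `j = n - k` give a nonzero anticommutator with `φ_n`, so the
  -- truncation must contain both.
  have h : ∀ k ∈ l.support, ∀ᶠ N : ℕ in atTop, n - k ∈ Finset.Icc (-(N : ℤ)) N :=
    fun k _ => eventually_mem_Icc _
  filter_upwards [(eventually_all_finset _).2 h, eventually_mem_Icc (-n)] with N h1 h2 W
  rw [hatBTrunc_apply, hatBTrunc_apply, map_smul, ← smul_sub]
  congr 1
  rw [Finsupp.sum, Finsupp.sum, Finsupp.sum, map_sum, ← Finset.sum_sub_distrib]
  refine Finset.sum_congr rfl fun k hk => ?_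
  have e1 : ∑ j ∈ Finset.Icc (-(N : ℤ)) N, ((-1 : ℂ) ^ (-j - k) * (l k).eval (j : ℂ)) •
      anticomm j n • phi (-j - k) W = ((-1) ^ k * (l k).eval (-(n : ℂ))) • phi (n - k) W := by
    rw [Finset.sum_eq_single_of_mem _ h2]
    · rw [neg_neg, anticomm, if_pos (by ring), smul_smul]
      push_cast
      congr 1
      have := neg_one_zpow_mul_self n
      rw [zpow_sub₀ (by norm_num), zpow_neg, inv_eq_of_mul_eq_one_left this, div_eq_mul_inv,
        inv_eq_of_mul_eq_one_left (neg_one_zpow_mul_self k)]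
      linear_combination (-1) ^ k * (l k).eval (-(n : ℂ)) * this
    · intro j _ hj
      rw [anticomm, if_neg (by omega), zero_smul, smul_zero]
  have e2 : ∑ j ∈ Finset.Icc (-(N : ℤ)) N, ((-1 : ℂ) ^ (-j - k) * (l k).eval (j : ℂ)) •
      anticomm (-j - k) n • phi j W = (l k).eval ((n - k : ℤ) : ℂ) • phi (n - k) W := by
    rw [Finset.sum_eq_single_of_mem _ (h1 k hk)]
    · rw [anticomm, if_pos (by ring), smul_smul, mul_right_comm, neg_one_zpow_mul_self, one_mul]
    · intro j _ hj
      rw [anticomm, if_neg (by omega), zero_smul, smul_zero]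
  simp only [normalOrdered_phi, smul_sub, smul_add, Finset.sum_sub_distrib, Finset.sum_add_distrib,
    e1, e2, map_sum, map_smul, sub_smul]
  abel

/-- The fermionic realization of an operator of energy at most one, paired with `⟨0|`. -/
theorem eventually_vev_hatBTrunc {l : DiffOp} (hl : EnergyLeOne l) :
    ∀ᶠ N in atTop, ∀ W : Fock,
      vev (hatBTrunc N l W) = zCoeff (antisymm l) * vev (phi 0 (phi (-1) W)) := by
  filter_upwards [eventually_mem_Icc 0, eventually_mem_Icc (-1)] with N h0 h1 W
  -- In energy one the indices add up to `-1`, so only the pairs `(-1, 0)` and `(0, -1)` avoid a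
  -- positive index. Half the sum of their weights is `zCoeff (antisymm l)`.
  have hone : ∑ j ∈ Finset.Icc (-(N : ℤ)) N, ((-1 : ℂ) ^ (-j - 1) * (l 1).eval (j : ℂ)) *
      vev (normalOrdered (-j - 1) j W)
        = ((l 1).eval 0 + (l 1).eval (-1)) * vev (phi 0 (phi (-1) W)) := by
    rw [Finset.sum_eq_add_of_mem 0 (-1) h0 h1 (by norm_num)]
    · norm_num [normalOrdered_zero_neg_one, normalOrdered_neg_one_zero]
      rw [← neg_one_smul ℂ (phi 0 _), vev_smul]
      simp
      ring
    · rintro j - ⟨hj, hj'⟩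
      have : vev (normalOrdered (-j - 1) j W) = 0 := by
        rcases lt_or_ge 0 j with h | h
        · rw [normalOrdered_of_right_pos _ h, ← neg_one_smul ℂ, vev_smul, vev_phi_of_pos h,
            mul_zero]
        · have h' : 0 < -j - 1 := by omega
          rw [normalOrdered_of_left_pos h', vev_phi_of_pos h']
      rw [this, mul_zero]
  have hsum : vev (hatBTrunc N l W) = 1 / 2 * ∑ k ∈ l.support, ∑ j ∈ Finset.Icc (-(N : ℤ)) N,
      ((-1 : ℂ) ^ (-j - k) * (l k).eval (j : ℂ)) * vev (normalOrdered (-j - k) j W) := by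
    rw [hatBTrunc_apply, Finsupp.sum, vev_smul, ← vevLinear_apply]
    simp only [map_sum, map_smul, smul_eq_mul, vevLinear_apply]
  rw [hsum, Finset.sum_eq_single 1, hone, zCoeff, antisymm_apply_eval]
  · norm_num
    ring
  · intro k hk hk1
    have hk' : k ≤ 0 := by
      by_contra h
      exact (Finsupp.mem_support_iff.1 hk) (hl k (by omega))
    refine Finset.sum_eq_zero fun j _ => ?_
    rw [vev_normalOrdered_of_nonneg (by omega), mul_zero]
  · intro h
    simp [Finsupp.notMem_support_iff.1 h]

/-! ### Wick's theorem -/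

theorem rightPhiZero_apply (W : Fock) (T : Finset ℕ) :
    rightPhiZero W T = (if 0 ∈ T then 1 else 1 / 2) * W (toggle 0 T) := by
  by_cases h : 0 ∈ T <;> simp [rightPhiZero, toggle, h]

/-- Right multiplication by `φ_0` commutes with left multiplication by any mode. -/
theorem rightPhiZero_phi (i : ℤ) (W : Fock) :
    rightPhiZero (phi i W) = phi i (rightPhiZero W) := by
  funext T
  rw [rightPhiZero_apply, phi_apply, phi_apply, rightPhiZero_apply,
    koszulSign_toggle_of_le (Nat.zero_le _), toggle_comm 0]
  by_cases hi : i = 0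
  · subst hi
    by_cases hT : 0 ∈ T <;> simp [hT, mem_toggle_self, upCoeff, downCoeff] <;> ring
  · have : i.natAbs ≠ 0 := by omega
    simp only [mem_toggle_of_ne this, mem_toggle_of_ne this.symm]
    ring

theorem vev_rightPhiZero (W : Fock) : vev (rightPhiZero W) = vev (phi 0 W) := by
  simp [vev, rightPhiZero_apply, phi_apply, downCoeff, koszulSign]

/-- Both sides are bilinear in `(f, g)`, so the coefficientwise identity extends by span induction
in each argument. -/
theorem SatisfiesBKP.eventually_dual {V : Fock} (hV : SatisfiesBKP V) {f g : Module.Dual ℂ Fock}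
    (hf : f ∈ finiteDual) (hg : g ∈ finiteDual) :
    ∀ᶠ N : ℕ in atTop, ∑ j ∈ Finset.Icc (-(N : ℤ)) N,
      (-1 : ℂ) ^ j * (f (phi j V) * g (phi (-j) V)) = f (rightPhiZero V) * g (rightPhiZero V) := by
  induction hf using Submodule.span_induction with
  | mem f hf =>
    obtain ⟨S, rfl⟩ := hf
    induction hg using Submodule.span_induction with
    | mem g hg =>
      obtain ⟨T, rfl⟩ := hg
      obtain ⟨A, hA⟩ := exists_natAbs_notMem S
      obtain ⟨B, hB⟩ := exists_natAbs_notMem T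
      have := eventually_finsum_eq_sum_Icc (B := A + B)
        (f := fun j : ℤ => (-1 : ℂ) ^ j * (phi j V S * phi (-j) V T)) fun j hj => by
          push_cast at hj
          rcases lt_abs.1 hj with h | h
          · rw [phi_apply_of_pos (by omega) _ (hA j (by omega))]; simp
          · rw [phi_apply_of_pos (i := -j) (by omega) _ (hB (-j) (by omega))]; simp
      filter_upwards [this] with N hN
      exact hN.symm.trans (hV S T)
    | zero => simp
    | add g₁ g₂ _ _ h₁ h₂ =>
      filter_upwards [h₁, h₂] with N h₁ h₂
      simp only [LinearMap.add_apply, mul_add, Finset.sum_add_distrib, h₁, h₂]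
    | smul c g _ h =>
      filter_upwards [h] with N h
      simp only [LinearMap.smul_apply, smul_eq_mul, mul_left_comm _ c, ← Finset.mul_sum, h]
  | zero => simp
  | add f₁ f₂ _ _ h₁ h₂ =>
    filter_upwards [h₁, h₂] with N h₁ h₂
    simp only [LinearMap.add_apply, add_mul, mul_add, Finset.sum_add_distrib, h₁, h₂]
  | smul c f _ h =>
    filter_upwards [h] with N h
    simp only [LinearMap.smul_apply, smul_eq_mul, mul_assoc, mul_left_comm _ c, ← Finset.mul_sum, h]

/-- Wick's theorem for the four-point function of a solution of the bilinear identity. -/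
theorem SatisfiesBKP.wick {V : Fock} (hV : SatisfiesBKP V) (a b c d : ℤ) :
    vev V * vev (phi d (phi a (phi b (phi c V)))) =
      vev (phi d (phi a V)) * vev (phi b (phi c V))
        - vev (phi d (phi b V)) * vev (phi a (phi c V))
        + vev (phi d (phi c V)) * vev (phi a (phi b V)) := by
  -- The identity is paired with `⟨0|φ_a φ_b φ_c ⊗ ⟨0|φ_d`; then `φ_j` and `φ_{-j}` are moved left,
  -- each anticommutator selecting one value of `j`.
  have hbil := hV.eventually_dual
    (comp_phi_mem (comp_phi_mem (comp_phi_mem vevLinear_mem a) b) c)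
    (comp_phi_mem vevLinear_mem d)
  obtain ⟨N, hN, ha, hb, hc, hd, h0⟩ := (hbil.and ((eventually_mem_Icc (-a)).and
    ((eventually_mem_Icc (-b)).and ((eventually_mem_Icc (-c)).and
      ((eventually_mem_Icc d).and (eventually_mem_Icc 0)))))).exists
  simp only [LinearMap.comp_apply, vevLinear_apply, ← rightPhiZero_phi, vev_rightPhiZero] at hN
  have hpick : ∀ (x : ℤ) (F : ℤ → ℂ), -x ∈ Finset.Icc (-(N : ℤ)) N →
      ∑ j ∈ Finset.Icc (-(N : ℤ)) N, (-1 : ℂ) ^ j * (anticomm x j * F j) = F (-x) := by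
    intro x F hx
    rw [Finset.sum_eq_single_of_mem _ hx]
    · rw [anticomm, if_pos (by ring), ← mul_assoc, zpow_neg,
        inv_mul_cancel₀ (zpow_ne_zero _ (by norm_num)), one_mul]
    · intro j _ hj
      rw [anticomm, if_neg (by omega)]; simp
  have hpick' : ∀ (F : ℤ → ℂ),
      ∑ j ∈ Finset.Icc (-(N : ℤ)) N, (-1 : ℂ) ^ j * (anticomm d (-j) * F j) = F d := by
    intro F
    rw [Finset.sum_eq_single_of_mem _ hd]
    · rw [anticomm, if_pos (by ring), ← mul_assoc, neg_one_zpow_mul_self, one_mul]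
    · intro j _ hj
      rw [anticomm, if_neg (by omega)]; simp
  -- For `j ≠ 0` one of `φ_j`, `φ_{-j}` is killed by `⟨0|`. The remaining `j = 0` term is the
  -- right-hand side of the bilinear identity, so the two cancel.
  have hzero : ∑ j ∈ Finset.Icc (-(N : ℤ)) N, (-1 : ℂ) ^ j *
      (vev (phi j (phi a (phi b (phi c V)))) * vev (phi (-j) (phi d V)))
      = vev (phi 0 (phi a (phi b (phi c V)))) * vev (phi 0 (phi d V)) := by
    rw [Finset.sum_eq_single_of_mem _ h0]
    · simp
    · intro j _ hj
      rcases lt_or_gt_of_ne hj with h | h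
      · rw [vev_phi_of_pos (i := -j) (by omega)]; simp
      · rw [vev_phi_of_pos h]; simp
  have hexp : ∀ j : ℤ, (-1 : ℂ) ^ j *
        (vev (phi a (phi b (phi c (phi j V)))) * vev (phi d (phi (-j) V))) =
      (-1 : ℂ) ^ j * (anticomm c j * (vev (phi a (phi b V)) * vev (phi d (phi (-j) V))))
      - (-1 : ℂ) ^ j * (anticomm b j * (vev (phi a (phi c V)) * vev (phi d (phi (-j) V))))
      + (-1 : ℂ) ^ j * (anticomm a j * (vev (phi b (phi c V)) * vev (phi d (phi (-j) V))))
      - (-1 : ℂ) ^ j * (anticomm d (-j) * (vev (phi j (phi a (phi b (phi c V)))) * vev V))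
      + (-1 : ℂ) ^ j * (vev (phi j (phi a (phi b (phi c V)))) * vev (phi (-j) (phi d V))) := by
    intro j
    have e1 : vev (phi a (phi b (phi c (phi j V)))) =
        anticomm c j * vev (phi a (phi b V)) - anticomm b j * vev (phi a (phi c V))
          + anticomm a j * vev (phi b (phi c V)) - vev (phi j (phi a (phi b (phi c V)))) := by
      rw [phi_phi c j, map_sub, map_smul, phi_phi b j, map_sub, map_smul, map_sub, map_smul,
        phi_phi a j]
      simp only [vev_sub, vev_smul]
      ring
    have e2 : vev (phi d (phi (-j) V)) = anticomm d (-j) * vev V - vev (phi (-j) (phi d V)) := by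
      rw [phi_phi d (-j), vev_sub, vev_smul]
    linear_combination (-1 : ℂ) ^ j * vev (phi d (phi (-j) V)) * e1
      - (-1 : ℂ) ^ j * vev (phi j (phi a (phi b (phi c V)))) * e2
  simp only [hexp, Finset.sum_add_distrib, Finset.sum_sub_distrib] at hN
  rw [hpick c _ hc, hpick b _ hb, hpick a _ ha, hpick', hzero] at hN
  simp only [neg_neg] at hN
  linear_combination -hN

/-! ### The two-point function and Kac–Schwarz operators -/

theorem actFst_add_actSnd_twoPoint {V : Fock} {l : DiffOp} (hl : EnergyLeOne l) {c : ℂ}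
    (hc : hatB l V = c • V) (m n : ℤ) :
    (antisymm l).actFst (twoPoint V) m n + (antisymm l).actSnd (twoPoint V) m n =
      (c * vev (phi m (phi n V))
        - zCoeff (antisymm l) * vev (phi 0 (phi (-1) (phi m (phi n V))))) / vev V := by
  obtain ⟨N, hV, hvev, hm, hn⟩ := ((eventually_dual_hatB_eq l V
    (comp_phi_mem (comp_phi_mem vevLinear_mem m) n)).and ((eventually_vev_hatBTrunc hl).and
    ((eventually_hatBTrunc_phi l m).and (eventually_hatBTrunc_phi l n)))).exists
  simp only [LinearMap.comp_apply, vevLinear_apply, hc, map_smul] at hV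
  -- The same number `⟨0| l̂ φ_m φ_n |V⟩` is evaluated twice: against `⟨0|` on the left, and by
  -- commuting the realization through to `|V⟩`.
  have h := hvev (phi m (phi n V))
  rw [hm, hn, map_sub, vev_sub, vev_sub, ← hV] at h
  rw [← h, DiffOp.actFst, DiffOp.actSnd, antisymm_act_apply, antisymm_act_apply]
  simp only [Finsupp.sum, twoPoint, map_smul, map_sum, vev_smul]
  simp only [← vevLinear_apply, map_sum, map_smul, smul_eq_mul, mul_div_assoc', ← Finset.sum_div]
  ring

theorem vev_smul_of_hatB {V : Fock} {l : DiffOp} (hl : EnergyLeOne l) {c : ℂ}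
    (hc : hatB l V = c • V) :
    c * vev V = zCoeff (antisymm l) * vev (phi 0 (phi (-1) V)) := by
  obtain ⟨N, hV, hvev⟩ := ((eventually_dual_hatB_eq l V vevLinear_mem).and
    (eventually_vev_hatBTrunc hl)).exists
  rw [← hvev, ← vev_smul, ← hc]
  exact hV

end BKP

theorem theorem4p8 (V : BKP.Fock) (hV : BKP.IsBigCellTau V)
    (l : BKP.DiffOp) (hl : BKP.IsLiftingOperator l V) :
    (BKP.antisymm l).actFst (BKP.twoPoint V) + (BKP.antisymm l).actSnd (BKP.twoPoint V)
      = fun m n => BKP.onePoint V m * BKP.onePoint' V n - BKP.onePoint V n * BKP.onePoint' V m := by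
  obtain ⟨c, hc⟩ := hl.kacSchwarz
  have hV0 := hV.bigCell
  have hcV := BKP.vev_smul_of_hatB hl.energy hc
  funext m n
  rw [Pi.add_apply, Pi.add_apply, BKP.actFst_add_actSnd_twoPoint hl.energy hc]
  -- The last argument of `wick` is the leftmost fermion, so this expands `⟨φ_0 φ_{-1} φ_m φ_n⟩`.
  have hw := hV.bilinear.wick (-1) m n 0
  rw [hl.normalized, one_mul] at hcV ⊢
  simp only [BKP.onePoint, BKP.onePoint']
  field_simp
  linear_combination BKP.vev (BKP.phi m (BKP.phi n V)) * hcV - hw
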